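/- Let $K$ be a field with algebraic closure $\overline{K}$. For $n\ge 1$, a polynomial mapping $f=(f_1,\dots,f_n):K^n\to K^n$, $f_i\in K[x_1,\dots,x_n]$, is called admissible if every $f_i$ has degree at least $2$ and the leading forms (homogeneous parts of highest degree) of $f_1,\dots,f_n$ have no common zero in $\overline{K}^n$ other than the origin. Define the following properties of $K$. (SP): for every $n\ge 1$ and every admissible polynomial mapping $f:K^n\to K^n$, every subset $X\subseteq K^n$ with $f(X)=X$ is finite. (P): the same implication for $n=1$ only. (K): for every $n\ge 1$, every admissible polynomial mapping $\Phi:K^n\to K^n$ and every polynomial mapping $\Psi:K^n\to K^n$ such that the minimum of the degrees of the polynomials defining $\Phi$ is larger than the maximum of the degrees of the polynomials defining $\Psi$, every subset $X\subseteq K^n$ such that $\Psi(X)\subseteq\Phi(X)$ and $\Psi|_X$ is injective is finite. ($\overline{\mathrm{P}}$): for every polynomial $f\in\overline{K}[x]$ of degree at least $2$, every subset $X\subseteq\overline{K}$ that consists of elements of uniformly bounded degree over $K$ and satisfies $X\subseteq f(X)$ is finite. (R): if $f\in K(x)$ is a rational function and there is an infinite subset $X\subseteq K$, containing no pole of $f$,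 with $f(X)=X$, then $f(x)=(\alpha x+\beta)/(\gamma x+\delta)$ for some $\alpha,\beta,\gamma,\delta\in K$ with $(\gamma,\delta)\neq(0,0)$. A subset $A$ of $\overline{\mathbb{Q}}$ has the Northcott property (N) if $\{x\in A: h(x)<T\}$ is finite for every real $T>0$, where $h$ is the absolute logarithmic Weil height on $\overline{\mathbb{Q}}$. Theorem. For every field $K$ the following implications hold: (K) $\Rightarrow$ (SP) $\Rightarrow$ (P), ($\overline{\mathrm{P}}$) $\Rightarrow$ (P), and (R) $\Rightarrow$ (P). Moreover, every subfield of $\overline{\mathbb{Q}}$ with property (N) has all of the properties (K), (SP), ($\overline{\mathrm{P}}$), (R) and (P). -/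

import Mathlib

open Polynomial

/-- A polynomial mapping `K^n → K^n`, given by the `n`-tuple of polynomials that define it. -/
abbrev PolyMap (K : Type*) [Field K] (n : ℕ) := Fin n → MvPolynomial (Fin n) K

namespace PolyMap

variable {K : Type*} [Field K] {n : ℕ}

/-- The map `K^n → K^n`, `x ↦ (f₁(x), …, fₙ(x))`. -/
noncomputable def toFun (f : PolyMap K n) (x : Fin n → K) : Fin n → K :=
  fun i => MvPolynomial.eval x (f i)

/-- The leading form of a polynomial: its homogeneous component of highest degree. -/
noncomputable def leadingForm (p : MvPolynomial (Fin n) K) : MvPolynomial (Fin n) K :=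
  MvPolynomial.homogeneousComponent p.totalDegree p

/-- A polynomial mapping is admissible if none of its components is linear (constants count as
linear) and the leading forms of the components have no common zero other than the origin over
the algebraic closure of `K`. -/
def IsAdmissible (f : PolyMap K n) : Prop :=
  (∀ i, 1 < (f i).totalDegree) ∧
    ∀ z : Fin n → AlgebraicClosure K,
      (∀ i, MvPolynomial.aeval z (leadingForm (f i)) = 0) → z = 0

end PolyMap

/-- For every admissible `f : K^n → K^n`, every `X ⊆ K^n` with `f(X) = X` is finite. -/
def FiniteInvariantSets (K : Type*) [Field K] (n : ℕ) : Prop :=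
  ∀ f : PolyMap K n, f.IsAdmissible → ∀ X : Set (Fin n → K), f.toFun '' X = X → X.Finite

/-- Property (SP). -/
def PropertySP (K : Type*) [Field K] : Prop :=
  ∀ n : ℕ, 0 < n → FiniteInvariantSets K n

/-- Property (P): the case `n = 1` of property (SP). -/
def PropertyP (K : Type*) [Field K] : Prop :=
  FiniteInvariantSets K 1

/-- Property (K). The condition `∀ i j, deg Ψⱼ < deg Φᵢ` says that the minimum of the degrees of
the components of `Φ` is larger than the maximum of the degrees of the components of `Ψ`. -/
def PropertyK (K : Type*) [Field K] : Prop :=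
  ∀ n : ℕ, 0 < n → ∀ Φ Ψ : PolyMap K n, Φ.IsAdmissible →
    (∀ i j, (Ψ j).totalDegree < (Φ i).totalDegree) →
    ∀ X : Set (Fin n → K), Ψ.toFun '' X ⊆ Φ.toFun '' X → Set.InjOn Ψ.toFun X → X.Finite

/-- Property (P̄). -/
def PropertyPbar (K : Type*) [Field K] : Prop :=
  ∀ f : (AlgebraicClosure K)[X], 1 < f.natDegree → ∀ S : Set (AlgebraicClosure K),
    (∃ D : ℕ, ∀ x ∈ S, (minpoly K x).natDegree ≤ D) →
    S ⊆ (fun x => f.eval x) '' S → S.Finite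

/-- Property (R). The equation `f(S) = S` for a subset `S` of `K` includes that `f` is defined on
`S`, that is, that no element of `S` is a pole of `f`. -/
def PropertyR (K : Type*) [Field K] : Prop :=
  ∀ f : RatFunc K,
    (∃ S : Set K, S.Infinite ∧ (∀ x ∈ S, f.denom.eval x ≠ 0) ∧
      (fun x => f.eval (RingHom.id K) x) '' S = S) →
    ∃ α β γ δ : K, RatFunc.C γ * RatFunc.X + RatFunc.C δ ≠ 0 ∧
      f = (RatFunc.C α * RatFunc.X + RatFunc.C β) / (RatFunc.C γ * RatFunc.X + RatFunc.C δ)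

/-- Property (N), the Northcott property, of a set of algebraic numbers, with respect to the
absolute logarithmic Weil height. -/
def PropertyN (A : Set (AlgebraicClosure ℚ)) : Prop :=
  ∀ T : ℝ, 0 < T → {x | x ∈ A ∧ NumberField.absLogHeight₁ x < T}.Finite

/-! Heights carry the proof. An admissible `Φ` with minimal degree `d` satisfies `h(Φ x) ≥ d·h(x) -
C`, while a `Ψ` with degrees at most `d - 1` satisfies `h(Ψ x) ≤ (d - 1)·h(x) + C'`. If `Ψ(X) ⊆
Φ(X)` and `Ψ` is injective on `X`, choosing `φ x ∈ X` with `Φ(φ x) = Ψ x` gives an injective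
self-map of `X` that lowers every sufficiently large height. By Northcott, the points of `X` up to a
given height form a finite set; an injective self-map of it is onto, so no point can lie above the
threshold (`Set.Finite.of_image_subset_of_height_le`).

The lower bound comes from the Nullstellensatz: high powers of the variables lie in the ideal of the
leading forms, and replacing leading forms by the polynomials themselves yields relations for all
homogeneous coordinates (`exists_relations`), which `exists_le_absLogHeight_eval` turns into
heights. For rational functions, Bézout relations play the same role.

For (P̄), the Northcott property passes to elements of bounded degree, since conjugates have equal
height and so the minimal polynomials have coefficients of bounded height. -/

/-! ### Heights under extension of number fields -/

section MulHeightExtension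

open NumberField Height

/-- The number of extensions of a complex embedding of `F` to a finite extension `L`. -/
lemma NumberField.card_ringHom_comp_algebraMap_eq {F L : Type*} [Field F] [NumberField F] [Field L]
    [NumberField L] [Algebra F L] [DecidableEq (F →+* ℂ)] (φ : F →+* ℂ) :
    (Finset.univ.filter fun ψ : L →+* ℂ => ψ.comp (algebraMap F L) = φ).card =
      Module.finrank F L := by
  let : Algebra F ℂ := φ.toAlgebra
  rw [← AlgHom.card F L ℂ, ← Fintype.card_subtype]
  refine Fintype.card_congr
    { toFun := fun ψ => { ψ.1 with commutes' := fun r => RingHom.congr_fun ψ.2 r }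
      invFun := fun ψ => ⟨ψ.toRingHom, ψ.comp_algebraMap⟩
      left_inv := fun ψ => rfl
      right_inv := fun ψ => rfl }

lemma NumberField.InfinitePlace.prod_pow_mult_eq_prod_embeddings {F : Type*} [Field F]
    [NumberField F] (f : InfinitePlace F → ℝ) :
    ∏ v : InfinitePlace F, f v ^ v.mult = ∏ φ : F →+* ℂ, f (InfinitePlace.mk φ) := by
  classical
  rw [← Finset.prod_fiberwise' Finset.univ InfinitePlace.mk f]
  refine Finset.prod_congr rfl fun v _ => ?_
  rw [Finset.prod_const]
  congr 1
  rw [← InfinitePlace.card_filter_mk_eq v]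

/-- Written over complex embeddings, the product absorbs the multiplicities, and each embedding of
`F` has exactly `[L : F]` extensions to `L`. -/
lemma NumberField.prod_infinitePlace_iSup_algebraMap {F L : Type*} [Field F] [NumberField F]
    [Field L] [NumberField L] [Algebra F L] {ι : Type*} (x : ι → F) :
    ∏ w : InfinitePlace L, (⨆ i, w (algebraMap F L (x i))) ^ w.mult =
      (∏ v : InfinitePlace F, (⨆ i, v (x i)) ^ v.mult) ^ Module.finrank F L := by
  classical
  rw [InfinitePlace.prod_pow_mult_eq_prod_embeddings fun w => ⨆ i, w (algebraMap F L (x i)),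
    InfinitePlace.prod_pow_mult_eq_prod_embeddings fun v => ⨆ i, v (x i), ← Finset.prod_pow,
    ← Finset.prod_fiberwise Finset.univ fun ψ : L →+* ℂ => ψ.comp (algebraMap F L)]
  refine Finset.prod_congr rfl fun φ _ => ?_
  rw [← card_ringHom_comp_algebraMap_eq (L := L) φ, ← Finset.prod_const]
  refine Finset.prod_congr rfl fun ψ hψ => ?_
  rw [← (Finset.mem_filter.mp hψ).2]
  rfl

/-- For integral entries the finite part is the inverse norm of the ideal they generate, and
extending an ideal to `L` raises its norm to the power `[L : F]`. -/
lemma NumberField.finprod_finitePlace_iSup_algebraMap {F L : Type*} [Field F] [NumberField F]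
    [Field L] [NumberField L] [Algebra F L] {ι : Type*} [Finite ι] {x : ι → 𝓞 F} (hx : x ≠ 0) :
    ∏ᶠ w : FinitePlace L, ⨆ i, w (algebraMap F L (x i)) =
      (∏ᶠ v : FinitePlace F, ⨆ i, v (x i)) ^ Module.finrank F L := by
  have hy : (fun i => algebraMap (𝓞 F) (𝓞 L) (x i)) ≠ 0 := by
    contrapose! hx
    ext i : 1
    exact (FaithfulSMul.algebraMap_injective (𝓞 F) (𝓞 L)) (by simpa using congrFun hx i)
  have h1 := absNorm_mul_finprod_finitePlace_eq_one hx
  have h2 := absNorm_mul_finprod_finitePlace_eq_one hy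
  have h3 : Ideal.span (Set.range fun i => algebraMap (𝓞 F) (𝓞 L) (x i)) =
      (Ideal.span (Set.range x)).map (algebraMap (𝓞 F) (𝓞 L)) := by
    rw [Ideal.map_span, ← Set.range_comp]; rfl
  rw [h3, Ideal.absNorm_algebraMap, Nat.cast_pow] at h2
  have h4 : Module.finrank (𝓞 F) (𝓞 L) = Module.finrank F L :=
    (IsFractionRing.finrank_eq (𝓞 F) F (𝓞 L) L).symm
  rw [h4] at h2
  have h5 := congrArg (· ^ Module.finrank F L) h1
  simp only [mul_pow, one_pow] at h5
  have h6 : (Ideal.absNorm (Ideal.span (Set.range x)) : ℝ) ^ Module.finrank F L ≠ 0 :=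
    left_ne_zero_of_mul_eq_one h5
  exact mul_left_cancel₀ h6 (h2.trans h5.symm)

/-- The multiplicative height of a tuple over a finite extension. -/
theorem NumberField.mulHeight_algebraMap {F L : Type*} [Field F] [NumberField F] [Field L]
    [NumberField L] [Algebra F L] {ι : Type*} [Finite ι] (x : ι → F) :
    mulHeight (fun i => algebraMap F L (x i)) = mulHeight x ^ Module.finrank F L := by
  rcases eq_or_ne x 0 with rfl | hx
  · simp only [Pi.zero_apply, map_zero]
    rw [mulHeight_zero, one_pow]
    exact mulHeight_zero
  -- Scaling leaves the projective height unchanged, so denominators may be cleared to reach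
  -- integral entries.
  obtain ⟨b, hb⟩ := IsLocalization.exist_integer_multiples_of_finite (nonZeroDivisors (𝓞 F)) x
  choose y hy using hb
  have hb0 : algebraMap (𝓞 F) F b ≠ 0 := by simp
  have hyx : (fun i => (y i : F)) = algebraMap (𝓞 F) F b • x := by
    ext i
    have := hy i
    simpa [Algebra.smul_def] using this
  have hy0 : y ≠ 0 := by
    rintro rfl
    have h : algebraMap (𝓞 F) F b • x = 0 := by rw [← hyx]; ext i; simp
    exact (smul_ne_zero hb0 hx) h
  have hyF0 : (fun i => (y i : F)) ≠ 0 := hyx ▸ smul_ne_zero hb0 hx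
  have hL : (fun i => algebraMap F L (y i)) =
      algebraMap F L (algebraMap (𝓞 F) F b) • fun i => algebraMap F L (x i) := by
    ext i
    have := congrFun hyx i
    rw [this]; simp
  have hL0 : (fun i => algebraMap F L (y i)) ≠ 0 := by
    contrapose! hyF0
    ext i
    exact (algebraMap F L).injective (by simpa using congrFun hyF0 i)
  rw [← mulHeight_smul_eq_mulHeight x hb0, ← hyx,
    ← mulHeight_smul_eq_mulHeight _ ((map_ne_zero (algebraMap F L)).2 hb0), ← hL,
    NumberField.mulHeight_eq hL0, NumberField.mulHeight_eq hyF0, mul_pow,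
    NumberField.prod_infinitePlace_iSup_algebraMap,
    NumberField.finprod_finitePlace_iSup_algebraMap hy0]

theorem NumberField.logHeight_algebraMap {F L : Type*} [Field F] [NumberField F] [Field L]
    [NumberField L] [Algebra F L] {ι : Type*} [Finite ι] (x : ι → F) :
    logHeight (fun i => algebraMap F L (x i)) = Module.finrank F L * logHeight x := by
  rw [logHeight_eq_log_mulHeight, mulHeight_algebraMap, Real.log_pow, logHeight_eq_log_mulHeight]

end MulHeightExtension

/-! ### The absolute logarithmic height of tuples -/

section AbsLogHeight

open NumberField Height

variable {Ω : Type*} [Field Ω] [CharZero Ω] [Algebra.IsAlgebraic ℚ Ω]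
variable {ι ι' : Type*} [Finite ι] [Finite ι']

lemma numberField_adjoin_range (x : ι → Ω) :
    NumberField (IntermediateField.adjoin ℚ (Set.range x)) where
  to_finiteDimensional :=
    have : Finite (Set.range x) := Set.finite_range x
    IntermediateField.finiteDimensional_adjoin
      fun a _ => (Algebra.IsAlgebraic.isAlgebraic a).isIntegral

/-- The absolute logarithmic (projective) Weil height of a tuple of algebraic numbers. -/
noncomputable def absLogHeight (x : ι → Ω) : ℝ :=
  haveI := numberField_adjoin_range x
  logHeight (fun i => (⟨x i, IntermediateField.subset_adjoin ℚ _ ⟨i, rfl⟩⟩ :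
    IntermediateField.adjoin ℚ (Set.range x))) /
    Module.finrank ℚ (IntermediateField.adjoin ℚ (Set.range x))

/-- The absolute height may be computed in any number field that contains the entries. -/
theorem absLogHeight_map {F : Type*} [Field F] [NumberField F] (σ : F →+* Ω) (y : ι → F) :
    absLogHeight (fun i => σ (y i)) = logHeight y / Module.finrank ℚ F := by
  set x : ι → Ω := fun i => σ (y i) with hx
  have hnf := numberField_adjoin_range x
  let s : F →ₐ[ℚ] Ω := RingHom.toRatAlgHom σ
  have hE : IntermediateField.adjoin ℚ (Set.range x) ≤ s.fieldRange := by
    rw [IntermediateField.adjoin_le_iff]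
    rintro _ ⟨i, rfl⟩
    exact ⟨y i, rfl⟩
  -- Inverting `σ` on its image embeds `ℚ(x)` in `F`; the factor `[F : ℚ(x)]` then cancels.
  let τ : IntermediateField.adjoin ℚ (Set.range x) →ₐ[ℚ] F :=
    (AlgEquiv.ofInjectiveField s).symm.toAlgHom.comp
      ((IntermediateField.adjoin ℚ (Set.range x)).val.codRestrict s.range fun e => hE e.2)
  have hτ : ∀ e, σ (τ e) = e := fun e =>
    congrArg Subtype.val ((AlgEquiv.ofInjectiveField s).apply_symm_apply ⟨e.1, hE e.2⟩)
  let : Algebra (IntermediateField.adjoin ℚ (Set.range x)) F := τ.toRingHom.toAlgebra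
  have : IsScalarTower ℚ (IntermediateField.adjoin ℚ (Set.range x)) F :=
    IsScalarTower.of_algebraMap_eq fun r => (τ.commutes r).symm
  have hy : y = fun i => algebraMap (IntermediateField.adjoin ℚ (Set.range x)) F
      ⟨x i, IntermediateField.subset_adjoin ℚ _ ⟨i, rfl⟩⟩ := by
    ext i
    apply σ.injective
    exact (hτ ⟨x i, IntermediateField.subset_adjoin ℚ _ ⟨i, rfl⟩⟩).symm
  have hfin : FiniteDimensional (IntermediateField.adjoin ℚ (Set.range x)) F :=
    FiniteDimensional.right ℚ _ F
  have h1 : (Module.finrank (IntermediateField.adjoin ℚ (Set.range x)) F : ℝ) ≠ 0 :=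
    Nat.cast_ne_zero.2 Module.finrank_pos.ne'
  rw [absLogHeight]
  conv_rhs => rw [hy, logHeight_algebraMap,
    ← Module.finrank_mul_finrank ℚ (IntermediateField.adjoin ℚ (Set.range x)) F]
  push_cast
  rw [mul_comm (Module.finrank ℚ _ : ℝ), mul_div_mul_left _ _ h1]

lemma exists_numberField_lift (x : ι → Ω) :
    ∃ (F : IntermediateField ℚ Ω) (_ : NumberField F) (y : ι → F), ∀ i, (y i : Ω) = x i :=
  ⟨_, numberField_adjoin_range x,
    fun i => ⟨x i, IntermediateField.subset_adjoin ℚ _ ⟨i, rfl⟩⟩, fun _ => rfl⟩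

lemma exists_numberField_lift₂ (x : ι → Ω) (x' : ι' → Ω) :
    ∃ (F : IntermediateField ℚ Ω) (_ : NumberField F) (y : ι → F) (y' : ι' → F),
      x = (fun i => algebraMap F Ω (y i)) ∧ x' = fun i => algebraMap F Ω (y' i) := by
  obtain ⟨F, hF, y, hy⟩ := exists_numberField_lift (Sum.elim x x')
  exact ⟨F, hF, fun i => y (.inl i), fun i => y (.inr i), funext fun i => (hy (.inl i)).symm,
    funext fun i => (hy (.inr i)).symm⟩

lemma absLogHeight_nonneg (x : ι → Ω) : 0 ≤ absLogHeight x := by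
  have := numberField_adjoin_range x
  exact div_nonneg (logHeight_nonneg _) (Nat.cast_nonneg _)

lemma absLogHeight_ringHom {Ω' : Type*} [Field Ω'] [CharZero Ω'] [Algebra.IsAlgebraic ℚ Ω']
    (σ : Ω →+* Ω') (x : ι → Ω) : absLogHeight (fun i => σ (x i)) = absLogHeight x := by
  obtain ⟨F, _, y, hy⟩ := exists_numberField_lift x
  obtain rfl : (fun i => algebraMap F Ω (y i)) = x := funext hy
  exact (absLogHeight_map (σ.comp (algebraMap F Ω)) y).trans
    (absLogHeight_map (algebraMap F Ω) y).symm

lemma absLogHeight_linearMap_le [Fintype ι] (A : ι' × ι → Ω) (x : ι → Ω) :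
    absLogHeight (fun j => ∑ i, A (j, i) * x i) ≤
      Real.log (Nat.card ι) + absLogHeight A + absLogHeight x := by
  obtain ⟨F, _, B, y, rfl, rfl⟩ := exists_numberField_lift₂ A x
  have h : (fun j => ∑ i, algebraMap F Ω (B (j, i)) * algebraMap F Ω (y i)) =
      fun j => algebraMap F Ω (∑ i, B (j, i) * y i) := by
    ext j; simp only [map_sum, map_mul]
  have hd : (0 : ℝ) < Module.finrank ℚ F := Nat.cast_pos.2 Module.finrank_pos
  rw [h, absLogHeight_map, absLogHeight_map, absLogHeight_map, div_le_iff₀ hd]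
  have := logHeight_linearMap_apply_le B y
  -- The archimedean constant has weight `[F : ℚ]`, so after division it no longer depends on `F`,
  -- which varies with `x`.
  rw [totalWeight_eq_finrank] at this
  field_simp
  linarith

lemma absLogHeight_fun_mul {x : ι → Ω} (hx : x ≠ 0) {y : ι' → Ω} (hy : y ≠ 0) :
    absLogHeight (fun a : ι × ι' => x a.1 * y a.2) = absLogHeight x + absLogHeight y := by
  obtain ⟨F, _, u, v, rfl, rfl⟩ := exists_numberField_lift₂ x y
  have hu : u ≠ 0 := by rintro rfl; exact hx (by ext; simp)
  have hv : v ≠ 0 := by rintro rfl; exact hy (by ext; simp)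
  simp only [← map_mul]
  rw [absLogHeight_map, absLogHeight_map, absLogHeight_map, logHeight_fun_mul_eq hu hv, add_div]

lemma absLogHeight_fun_prod {x : ι → Ω} (hx : x ≠ 0) (N : ℕ) :
    absLogHeight (fun g : Fin N → ι => ∏ k, x (g k)) = N * absLogHeight x := by
  obtain ⟨F, _, u, hu⟩ := exists_numberField_lift x
  obtain rfl : (fun i => algebraMap F Ω (u i)) = x := funext hu
  have hu : u ≠ 0 := by rintro rfl; exact hx (by ext; simp)
  simp only [← map_prod]
  rw [absLogHeight_map, absLogHeight_map, logHeight_fun_prod_eq (fun _ => hu)]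
  simp [mul_div_assoc]

lemma absLogHeight_pow (x : ι → Ω) (N : ℕ) :
    absLogHeight (fun i => x i ^ N) = N * absLogHeight x := by
  obtain ⟨F, _, u, hu⟩ := exists_numberField_lift x
  obtain rfl : (fun i => algebraMap F Ω (u i)) = x := funext hu
  simp only [← map_pow]
  rw [absLogHeight_map, absLogHeight_map, ← mul_div_assoc, ← logHeight_pow]
  rfl

lemma absLogHeight_comp_le (f : ι → ι') (x : ι' → Ω) :
    absLogHeight (fun i => x (f i)) ≤ absLogHeight x := by
  obtain ⟨F, _, u, hu⟩ := exists_numberField_lift x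
  obtain rfl : (fun i => algebraMap F Ω (u i)) = x := funext hu
  rw [absLogHeight_map, absLogHeight_map]
  exact div_le_div_of_nonneg_right (logHeight_comp_le f u) (Nat.cast_nonneg _)

lemma absLogHeight₁_map {F : Type*} [Field F] [NumberField F] (σ : F →+* Ω) (y : F) :
    absLogHeight ![σ y, 1] = logHeight₁ y / Module.finrank ℚ F := by
  rw [logHeight₁_eq_logHeight, ← absLogHeight_map σ]
  congr 1
  ext i
  fin_cases i <;> simp

open IntermediateField in
lemma absLogHeight₁_eq (x : Ω) : absLogHeight₁ x = absLogHeight ![x, 1] := by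
  have hx : IsIntegral ℚ x := (Algebra.IsAlgebraic.isAlgebraic x).isIntegral
  have hfin : FiniteDimensional ℚ ℚ⟮x⟯ := adjoin.finiteDimensional hx
  have hnf : NumberField ℚ⟮x⟯ := {}
  have h := absLogHeight₁_map (algebraMap ℚ⟮x⟯ Ω) (AdjoinSimple.gen ℚ x)
  rw [AdjoinSimple.algebraMap_gen] at h
  rw [h, absLogHeight₁, absMulHeight₁, dif_pos hx, Real.log_rpow (mulHeight₁_pos _),
    logHeight₁_eq_log_mulHeight₁, inv_mul_eq_div]

lemma absLogHeight₁_ringHom {Ω' : Type*} [Field Ω'] [CharZero Ω'] [Algebra.IsAlgebraic ℚ Ω']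
    (σ : Ω →+* Ω') (x : Ω) : absLogHeight₁ (σ x) = absLogHeight₁ x := by
  rw [absLogHeight₁_eq, absLogHeight₁_eq, ← absLogHeight_ringHom σ]
  congr 1
  ext i
  fin_cases i <;> simp

lemma absLogHeight₁_mul_le (x y : Ω) :
    absLogHeight₁ (x * y) ≤ absLogHeight₁ x + absLogHeight₁ y := by
  obtain ⟨F, _, u, hu⟩ := exists_numberField_lift ![x, y]
  have h0 : algebraMap F Ω (u 0) = x := hu 0
  have h1 : algebraMap F Ω (u 1) = y := hu 1
  rw [← h0, ← h1, ← map_mul, absLogHeight₁_eq, absLogHeight₁_eq, absLogHeight₁_eq,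
    absLogHeight₁_map, absLogHeight₁_map, absLogHeight₁_map, ← add_div]
  exact div_le_div_of_nonneg_right (logHeight₁_mul_le _ _) (Nat.cast_nonneg _)

lemma absLogHeight₁_sub_le (x y : Ω) :
    absLogHeight₁ (x - y) ≤ Real.log 2 + absLogHeight₁ x + absLogHeight₁ y := by
  obtain ⟨F, _, u, hu⟩ := exists_numberField_lift ![x, y]
  have h0 : algebraMap F Ω (u 0) = x := hu 0
  have h1 : algebraMap F Ω (u 1) = y := hu 1
  have hd : (0 : ℝ) < Module.finrank ℚ F := Nat.cast_pos.2 Module.finrank_pos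
  have := logHeight₁_sub_le (u 0) (u 1)
  rw [totalWeight_eq_finrank] at this
  rw [← h0, ← h1, ← map_sub, absLogHeight₁_eq, absLogHeight₁_eq, absLogHeight₁_eq,
    absLogHeight₁_map, absLogHeight₁_map, absLogHeight₁_map, div_le_iff₀ hd]
  field_simp
  linarith

end AbsLogHeight

/-! ### Polynomials as linear forms in monomials -/

section Monomials

variable {R σ : Type*} [CommSemiring R]

/-- The index `none` is the homogenising coordinate `1`, which pads a monomial to exactly `N`
factors. -/
lemma MvPolynomial.exists_prod_elim_eq_monomial (N : ℕ) (s : σ →₀ ℕ) (hs : s.degree ≤ N) :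
    ∃ g : Fin N → Option σ,
      ∏ k, (g k).elim 1 MvPolynomial.X = MvPolynomial.monomial s (1 : R) := by
  classical
  induction N generalizing s with
  | zero =>
    obtain rfl : s = 0 := by simpa [Finsupp.degree_eq_zero_iff] using hs
    exact ⟨Fin.elim0, by simp⟩
  | succ N ih =>
    rcases eq_or_ne s 0 with rfl | h0
    · exact ⟨fun _ => none, by simp⟩
    · obtain ⟨i, hi⟩ := Finsupp.ne_iff.mp h0
      have hi' : Finsupp.single i 1 ≤ s := by
        rw [Finsupp.single_le_iff]; exact Nat.one_le_iff_ne_zero.2 hi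
      obtain ⟨t, rfl⟩ := exists_add_of_le hi'
      have ht : t.degree ≤ N := by
        rw [map_add, Finsupp.degree_single] at hs; omega
      obtain ⟨g, hg⟩ := ih t ht
      refine ⟨Fin.cons (some i) g, ?_⟩
      rw [Fin.prod_univ_succ]
      simp only [Fin.cons_zero, Fin.cons_succ, hg, Option.elim_some]
      rw [MvPolynomial.X, MvPolynomial.monomial_mul, one_mul]

lemma MvPolynomial.exists_eval_eq_sum_prod_elim [Fintype σ] (N : ℕ) (p : MvPolynomial σ R)
    (hp : p.totalDegree ≤ N) :
    ∃ c : (Fin N → Option σ) → R, ∀ x : σ → R,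
      MvPolynomial.eval x p = ∑ g, c g * ∏ k, (g k).elim 1 x := by
  have h : p ∈ Submodule.span R (Set.range fun g : Fin N → Option σ =>
      ∏ k, (g k).elim 1 (MvPolynomial.X (R := R))) := by
    rw [p.as_sum]
    refine Submodule.sum_mem _ fun s hs => ?_
    obtain ⟨g, hg⟩ := exists_prod_elim_eq_monomial (R := R) N s
      ((MvPolynomial.le_totalDegree hs).trans hp)
    rw [← mul_one (MvPolynomial.coeff s p), ← smul_eq_mul, ← MvPolynomial.smul_monomial, ← hg]
    exact Submodule.smul_mem _ _ (Submodule.subset_span ⟨g, rfl⟩)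
  obtain ⟨c, hc⟩ := (Submodule.mem_span_range_iff_exists_fun R).1 h
  refine ⟨c, fun x => ?_⟩
  rw [← hc, map_sum]
  refine Finset.sum_congr rfl fun g _ => ?_
  rw [MvPolynomial.smul_eval, map_prod]
  congr 1
  refine Finset.prod_congr rfl fun k _ => ?_
  cases g k <;> simp

end Monomials

/-! ### Height bounds for polynomial mappings -/

section PolynomialHeight

/-- Homogeneous coordinates of a point of affine space. -/
def affinePoint {Ω σ : Type*} [Field Ω] (x : σ → Ω) (o : Option σ) : Ω := o.elim 1 x

lemma affinePoint_ne_zero {Ω σ : Type*} [Field Ω] (x : σ → Ω) : affinePoint x ≠ 0 :=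
  fun h => one_ne_zero (congrFun h none)

variable {Ω : Type*} [Field Ω] [CharZero Ω] [Algebra.IsAlgebraic ℚ Ω]
variable {σ ι : Type*} [Fintype σ] [Fintype ι]

/-- The values are a fixed linear map applied to the degree `N` monomials in homogeneous
coordinates, a tuple of height `N·h(x)`. -/
theorem exists_absLogHeight_eval_le (N : ℕ) (P : ι → MvPolynomial σ Ω)
    (hP : ∀ i, (P i).totalDegree ≤ N) :
    ∃ C : ℝ, ∀ x : σ → Ω, absLogHeight (fun i => MvPolynomial.eval x (P i)) ≤
      N * absLogHeight (affinePoint x) + C := by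
  classical
  choose c hc using fun i => MvPolynomial.exists_eval_eq_sum_prod_elim N (P i) (hP i)
  let A : ι × (Fin N → Option σ) → Ω := fun a => c a.1 a.2
  refine ⟨Real.log (Nat.card (Fin N → Option σ)) + absLogHeight A, fun x => ?_⟩
  have h := absLogHeight_linearMap_le A
    (fun g => ∏ k, affinePoint x (g k))
  rw [absLogHeight_fun_prod (affinePoint_ne_zero x)] at h
  simp_rw [hc]
  rw [add_comm]
  exact h

/-- The relations write the powers `x_o ^ (M + N)` as a fixed linear map of the products of degree
`M` monomials with the `P i`, so `(M + N)·h(x) ≤ M·h(x) + h(P(x)) + C`. -/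
theorem exists_le_absLogHeight_eval (M N : ℕ) (P : ι → MvPolynomial σ Ω)
    (q : Option σ → ι → MvPolynomial σ Ω) (hq : ∀ o i, (q o i).totalDegree ≤ M)
    (h : ∀ o, ∑ i, q o i * P i = (o.elim 1 MvPolynomial.X) ^ (M + N)) :
    ∃ C : ℝ, ∀ x : σ → Ω, N * absLogHeight (affinePoint x) ≤
      absLogHeight (fun i => MvPolynomial.eval x (P i)) + C := by
  classical
  choose c hc using fun o i => MvPolynomial.exists_eval_eq_sum_prod_elim M (q o i) (hq o i)
  let A : Option σ × ((Fin M → Option σ) × ι) → Ω := fun a => c a.1 a.2.2 a.2.1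
  refine ⟨Real.log (Nat.card ((Fin M → Option σ) × ι)) + absLogHeight A, fun x => ?_⟩
  have hx : ∀ o, ∑ i, MvPolynomial.eval x (q o i) * MvPolynomial.eval x (P i) =
      affinePoint x o ^ (M + N) := fun o => by
    have := congrArg (MvPolynomial.eval x) (h o)
    simp only [map_sum, map_mul, map_pow] at this
    rw [this]
    cases o <;> simp [affinePoint]
  -- The relation at `none` has right side `1`, so the values have no common zero.
  have hP0 : (fun i => MvPolynomial.eval x (P i)) ≠ 0 := fun h0 => by
    have h1 := hx none
    simp only [fun i => show MvPolynomial.eval x (P i) = 0 from congrFun h0 i] at h1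
    simp [affinePoint] at h1
  have hm0 : (fun g : Fin M → Option σ => ∏ k, affinePoint x (g k)) ≠ 0 := fun h0 => by
    have := congrFun h0 (fun _ => none)
    simp [affinePoint] at this
  have key := absLogHeight_linearMap_le A (fun a : (Fin M → Option σ) × ι =>
    (∏ k, affinePoint x (a.1 k)) * MvPolynomial.eval x (P a.2))
  have e : (fun o => ∑ a, A (o, a) * ((∏ k, affinePoint x (a.1 k)) *
      MvPolynomial.eval x (P a.2))) = fun o => affinePoint x o ^ (M + N) := by
    ext o
    rw [← hx, Fintype.sum_prod_type_right]
    refine Finset.sum_congr rfl fun i _ => ?_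
    rw [hc, Finset.sum_mul]
    refine Finset.sum_congr rfl fun g _ => ?_
    simp only [A, affinePoint]
    ring
  rw [e, absLogHeight_pow, absLogHeight_fun_mul hm0 hP0,
    absLogHeight_fun_prod (affinePoint_ne_zero x)] at key
  push_cast at key
  linarith

end PolynomialHeight

/-! ### Ideal relations for admissible mappings -/

section AdmissibleAlgebra

open MvPolynomial

lemma MvPolynomial.homogeneousComponent_mul_of_isHomogeneous {σ R : Type*} [CommSemiring R]
    {φ : MvPolynomial σ R} {d : ℕ} (hφ : φ.IsHomogeneous d) (a : MvPolynomial σ R) {m : ℕ}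
    (hm : d ≤ m) :
    homogeneousComponent m (a * φ) = homogeneousComponent (m - d) a * φ := by
  classical
  let := MvPolynomial.gradedAlgebra (σ := σ) (R := R)
  have h := DirectSum.coe_decompose_mul_of_right_mem_of_le (homogeneousSubmodule σ R) (a := a)
    ((mem_homogeneousSubmodule d φ).2 hφ) hm
  have e : ∀ (p : MvPolynomial σ R) (k : ℕ),
      (DirectSum.decompose (homogeneousSubmodule σ R) p k : MvPolynomial σ R) =
        homogeneousComponent k p := fun p k => decomposition.decompose'_apply p k
  rwa [e, e] at h

lemma MvPolynomial.totalDegree_sub_leadingForm_le {K : Type*} [Field K] {n : ℕ}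
    (f : MvPolynomial (Fin n) K) :
    (PolyMap.leadingForm f - f).totalDegree ≤ f.totalDegree - 1 := by
  refine Finset.sup_le fun s hs => ?_
  change s.degree ≤ _
  rw [mem_support_iff, coeff_sub, PolyMap.leadingForm, coeff_homogeneousComponent] at hs
  by_cases h : s.degree = f.totalDegree
  · simp [h] at hs
  · rw [if_neg h, zero_sub, neg_ne_zero, ← mem_support_iff] at hs
    have := le_totalDegree hs
    change s.degree ≤ _ at this
    omega

/-- `p = q₀ + ∑ qᵢ fᵢ` with `deg q₀ ≤ B` and `deg qᵢ ≤ E`. -/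
def HasBoundedReduction {K : Type*} [Field K] {n : ℕ} (f : PolyMap K n) (B E : ℕ)
    (p : MvPolynomial (Fin n) K) : Prop :=
  ∃ (q₀ : MvPolynomial (Fin n) K) (q : Fin n → MvPolynomial (Fin n) K),
    q₀.totalDegree ≤ B ∧ (∀ i, (q i).totalDegree ≤ E) ∧ p = q₀ + ∑ i, q i * f i

namespace HasBoundedReduction

variable {K : Type*} [Field K] {n : ℕ} {f : PolyMap K n} {B E : ℕ}

lemma of_totalDegree_le {p : MvPolynomial (Fin n) K} (h : p.totalDegree ≤ B) :
    HasBoundedReduction f B E p :=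
  ⟨p, 0, h, by simp, by simp⟩

lemma add {p p' : MvPolynomial (Fin n) K} (h : HasBoundedReduction f B E p)
    (h' : HasBoundedReduction f B E p') : HasBoundedReduction f B E (p + p') := by
  obtain ⟨a, q, ha, hq, rfl⟩ := h
  obtain ⟨a', q', ha', hq', rfl⟩ := h'
  refine ⟨a + a', q + q', (totalDegree_add _ _).trans (max_le ha ha'),
    fun i => (totalDegree_add _ _).trans (max_le (hq i) (hq' i)), ?_⟩
  simp only [Pi.add_apply, add_mul, Finset.sum_add_distrib]
  ring

lemma mono {E' : ℕ} (hE : E ≤ E') {p : MvPolynomial (Fin n) K}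
    (h : HasBoundedReduction f B E p) : HasBoundedReduction f B E' p := by
  obtain ⟨a, q, ha, hq, rfl⟩ := h
  exact ⟨a, q, ha, fun i => (hq i).trans hE, rfl⟩

end HasBoundedReduction

namespace PolyMap.IsAdmissible

variable {K : Type*} [Field K] {n : ℕ} {f : PolyMap K n}

/-- A high power of each variable lies in the ideal of the leading forms. -/
lemma exists_X_pow_eq_sum (hf : f.IsAdmissible) :
    ∃ m : ℕ, (∀ i, (f i).totalDegree ≤ m) ∧ ∀ j, ∃ a : Fin n → MvPolynomial (Fin n) K,
      (∀ i, (a i).totalDegree ≤ m - (f i).totalDegree) ∧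
        (X j : MvPolynomial (Fin n) K) ^ m = ∑ i, a i * leadingForm (f i) := by
  classical
  set I : Ideal (MvPolynomial (Fin n) K) := Ideal.span (Set.range fun i => leadingForm (f i))
  have hI : ∀ j, ∃ m, (X j : MvPolynomial (Fin n) K) ^ m ∈ I := by
    intro j
    have h : (X j : MvPolynomial (Fin n) K) ∈ I.radical := by
      rw [← vanishingIdeal_zeroLocus_eq_radical (K := AlgebraicClosure K), mem_vanishingIdeal_iff]
      intro z hz
      rw [zeroLocus_span] at hz
      rw [hf.2 z fun i => hz _ ⟨i, rfl⟩]
      simp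
    exact h
  choose e he using hI
  let m := ∑ j, e j + ∑ i, (f i).totalDegree
  have hd : ∀ i, (f i).totalDegree ≤ m := fun i =>
    (Finset.single_le_sum (f := fun i => (f i).totalDegree) (fun _ _ => Nat.zero_le _)
      (Finset.mem_univ i)).trans (Nat.le_add_left _ _)
  have hem : ∀ j, e j ≤ m := fun j =>
    (Finset.single_le_sum (f := e) (fun _ _ => Nat.zero_le _)
      (Finset.mem_univ j)).trans (Nat.le_add_right _ _)
  refine ⟨m, hd, fun j => ?_⟩
  have hj : (X j : MvPolynomial (Fin n) K) ^ m ∈ I := I.pow_mem_of_pow_mem (he j) (hem j)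
  obtain ⟨a, ha⟩ := (Ideal.mem_span_range_iff_exists_fun).1 hj
  -- Only the degree `m` part of the relation matters, which bounds the degrees of the coefficients.
  refine ⟨fun i => homogeneousComponent (m - (f i).totalDegree) (a i), fun i =>
    (homogeneousComponent_isHomogeneous _ _).totalDegree_le, ?_⟩
  have h1 := congrArg (homogeneousComponent m) ha
  rw [map_sum, homogeneousComponent_of_mem (isHomogeneous_X_pow j m), if_pos rfl] at h1
  rw [← h1]
  refine Finset.sum_congr rfl fun i _ => ?_
  exact homogeneousComponent_mul_of_isHomogeneous (homogeneousComponent_isHomogeneous _ _) _ (hd i)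

/-- Division with remainder: a monomial of degree above `n * m` is divisible by some `X j ^ m`, a
combination of leading forms; replacing these by the `f i` leaves an error of smaller degree. The
bound `B` does not depend on `k`. -/
lemma exists_hasBoundedReduction (hf : f.IsAdmissible) {d : ℕ} (hd : ∀ i, d ≤ (f i).totalDegree) :
    ∃ B, ∀ k, ∀ p : MvPolynomial (Fin n) K, p.totalDegree ≤ k →
      HasBoundedReduction f B (k - d) p := by
  classical
  obtain ⟨m, hm, hX⟩ := hf.exists_X_pow_eq_sum
  refine ⟨n * m, fun k => ?_⟩
  induction k with
  | zero => exact fun p hp => .of_totalDegree_le (hp.trans (Nat.zero_le _))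
  | succ k ih =>
    have ih' : ∀ p : MvPolynomial (Fin n) K, p.totalDegree ≤ k →
        HasBoundedReduction f (n * m) (k + 1 - d) p := fun p hp => (ih p hp).mono (by omega)
    have hmon : ∀ (s : Fin n →₀ ℕ) (c : K), s.degree ≤ k + 1 →
        HasBoundedReduction f (n * m) (k + 1 - d) (monomial s c) := by
      intro s c hs
      by_cases hk : s.degree ≤ n * m
      · exact .of_totalDegree_le ((totalDegree_monomial_le _ _).trans hk)
      obtain ⟨j, hj⟩ : ∃ j, m ≤ s j := by
        by_contra! hlt
        refine hk ?_
        rw [Finsupp.degree_eq_sum]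
        exact (Finset.sum_le_card_nsmul _ _ m fun j _ => (hlt j).le).trans (by simp)
      obtain ⟨a, ha, hXa⟩ := hX j
      obtain ⟨t, rfl⟩ := exists_add_of_le (Finsupp.single_le_iff.2 hj)
      rw [map_add, Finsupp.degree_single] at hs
      have e : monomial (Finsupp.single j m + t) c =
          monomial t c * ∑ i, a i * (leadingForm (f i) - f i) +
            (0 + ∑ i, (monomial t c * a i) * f i) := by
        have : monomial (Finsupp.single j m + t) c = monomial t c * X j ^ m := by
          rw [MvPolynomial.X_pow_eq_monomial, monomial_mul, mul_one, add_comm]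
        rw [this, hXa, zero_add, Finset.mul_sum, Finset.mul_sum, ← Finset.sum_add_distrib]
        exact Finset.sum_congr rfl fun i _ => by ring
      have hmt : (monomial t c).totalDegree ≤ t.degree := totalDegree_monomial_le t c
      rw [e]
      refine HasBoundedReduction.add ?_
        ⟨0, fun i => monomial t c * a i, by simp, fun i => ?_, rfl⟩
      -- A component must exist to force `m > 0`, without which the bound `m - 1` would not lower
      -- the degree.
      · rcases Nat.eq_zero_or_pos n with rfl | hn
        · exact .of_totalDegree_le (by simp)
        refine ih' _ ?_
        have h2 : (∑ i, a i * (leadingForm (f i) - f i)).totalDegree ≤ m - 1 := by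
          refine totalDegree_finsetSum_le fun i _ => ?_
          have h1 := totalDegree_mul (a i) (leadingForm (f i) - f i)
          have h3 := totalDegree_sub_leadingForm_le (f i)
          have h4 := ha i
          have h5 := hm i
          have h6 := hf.1 i
          omega
        have h7 := totalDegree_mul (monomial t c) (∑ i, a i * (leadingForm (f i) - f i))
        have h8 := hm ⟨0, hn⟩
        have h9 := hf.1 ⟨0, hn⟩
        omega
      · change (monomial t c * a i).totalDegree ≤ k + 1 - d
        have h1 := totalDegree_mul (monomial t c) (a i)
        have h4 := ha i
        have h5 := hm i
        have h6 := hd i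
        omega
    intro p hp
    rw [p.as_sum]
    refine Finset.sum_induction _ (HasBoundedReduction f (n * m) (k + 1 - d))
      (fun _ _ => HasBoundedReduction.add) (.of_totalDegree_le (by simp)) fun s hs => ?_
    exact hmon s _ ((le_totalDegree hs).trans hp)

/-- The relations that bound the height from below under an admissible mapping. -/
lemma exists_relations (hf : f.IsAdmissible) {d : ℕ} (hd : ∀ i, d ≤ (f i).totalDegree) :
    ∃ (M : ℕ) (q : Option (Fin n) → Option (Fin n) → MvPolynomial (Fin n) K),
      (∀ o i, (q o i).totalDegree ≤ M) ∧
        ∀ o, ∑ i, q o i * i.elim 1 f = (o.elim 1 X) ^ (M + d) := by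
  obtain ⟨B, hB⟩ := hf.exists_hasBoundedReduction hd
  -- The exponent `B + d` makes the quotients, like the remainder, have degree at most `B`; the
  -- remainder becomes the coefficient of the coordinate `1`.
  have h : ∀ o : Option (Fin n),
      HasBoundedReduction f B B ((o.elim 1 X : MvPolynomial (Fin n) K) ^ (B + d)) := by
    intro o
    have := hB (B + d) ((o.elim 1 X : MvPolynomial (Fin n) K) ^ (B + d)) ?_
    · rwa [Nat.add_sub_cancel] at this
    · cases o with
      | none => simp
      | some j => simp
  choose q₀ q h₀ hq hsum using h
  refine ⟨B, fun o i => i.elim (q₀ o) (q o), fun o i => ?_, fun o => ?_⟩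
  · cases i with
    | none => exact h₀ o
    | some i => exact hq o i
  · rw [hsum o, Fintype.sum_option]
    simp

end PolyMap.IsAdmissible

end AdmissibleAlgebra

/-! ### Injective maps that decrease the height -/

section Dynamics

/-- A set on which bounded height implies finiteness is finite as soon as it carries an injective
self-map that eventually decreases the height. -/
theorem Set.Finite.of_injOn_of_height_le {α : Type*} {X : Set α} {h : α → ℝ} {φ : α → α}
    (hφ : Set.MapsTo φ X X) (hinj : Set.InjOn φ X) {d e C : ℝ} (he : 0 ≤ e) (hed : e < d)
    (hle : ∀ x ∈ X, d * h (φ x) ≤ e * h x + C) (hfin : ∀ T, {x | x ∈ X ∧ h x ≤ T}.Finite) :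
    X.Finite := by
  -- Above `C / (d - e)`, the fixed point of `t ↦ (e * t + C) / d`, heights drop.
  refine (hfin (C / (d - e))).subset fun x hx => ⟨hx, ?_⟩
  by_contra! hlt
  rw [div_lt_iff₀ (sub_pos.2 hed)] at hlt
  have hd : 0 < d := he.trans_lt hed
  have hdec : ∀ y ∈ X, h y ≤ h x → h (φ y) < h x := by
    intro y hy hyx
    have h1 := hle y hy
    have h2 := mul_le_mul_of_nonneg_left hyx he
    have h3 : d * h (φ y) < d * h x := by linarith
    exact lt_of_mul_lt_mul_left h3 hd.le
  set Y : Set α := {y | y ∈ X ∧ h y ≤ h x}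
  have hY : Y.Finite := hfin _
  have hmaps : Set.MapsTo φ Y Y := fun y hy => ⟨hφ hy.1, (hdec y hy.1 hy.2).le⟩
  -- An injective self-map of the finite set `Y` is onto, yet every image has height below `h x`, so
  -- `x` is missed.
  have hsurj : φ '' Y = Y := Set.eq_of_subset_of_ncard_le hmaps.image_subset
    (hinj.mono fun y hy => hy.1).ncard_image.ge hY
  obtain ⟨y, hy, hyx⟩ := hsurj.ge ⟨hx, le_rfl⟩
  exact (hdec y hy.1 hy.2).ne (by rw [hyx])

theorem Set.Finite.of_image_subset_of_height_le {α β : Type*} {X : Set α} {A B : α → β}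
    (hBA : B '' X ⊆ A '' X) (hinj : Set.InjOn B X) {h : α → ℝ} {H : β → ℝ} {d e C C' : ℝ}
    (he : 0 ≤ e) (hed : e < d) (hA : ∀ x ∈ X, d * h x ≤ H (A x) + C)
    (hB : ∀ x ∈ X, H (B x) ≤ e * h x + C') (hfin : ∀ T, {x | x ∈ X ∧ h x ≤ T}.Finite) :
    X.Finite := by
  have hex : ∀ x, ∃ y, x ∈ X → y ∈ X ∧ A y = B x := by
    intro x
    by_cases hx : x ∈ X
    · obtain ⟨y, hy, hyx⟩ := hBA ⟨x, hx, rfl⟩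
      exact ⟨y, fun _ => ⟨hy, hyx⟩⟩
    · exact ⟨x, fun h => absurd h hx⟩
  choose φ hφ using hex
  refine Set.Finite.of_injOn_of_height_le (h := h) (φ := φ) (C := C + C')
    (fun x hx => (hφ x hx).1) (fun x hx y hy hxy => ?_) he hed (fun x hx => ?_) hfin
  · exact hinj hx hy (by rw [← (hφ x hx).2, ← (hφ y hy).2, hxy])
  · have h1 := hA _ (hφ x hx).1
    rw [(hφ x hx).2] at h1
    linarith [hB x hx]

end Dynamics

/-! ### Heights under rational functions of one variable -/

section OneVariable

variable {Ω : Type*} [Field Ω]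

lemma MvPolynomial.totalDegree_aeval_X_le {σ : Type*} (i : σ) (p : Polynomial Ω) :
    (Polynomial.aeval (MvPolynomial.X i : MvPolynomial σ Ω) p).totalDegree ≤ p.natDegree := by
  rw [Polynomial.aeval_eq_sum_range]
  refine MvPolynomial.totalDegree_finsetSum_le fun k hk => ?_
  refine (MvPolynomial.totalDegree_smul_le _ _).trans ?_
  rw [MvPolynomial.totalDegree_X_pow]
  exact Nat.lt_succ_iff.1 (Finset.mem_range.1 hk)

lemma MvPolynomial.eval_aeval_X {σ : Type*} (i : σ) (p : Polynomial Ω) (x : σ → Ω) :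
    MvPolynomial.eval x (Polynomial.aeval (MvPolynomial.X i : MvPolynomial σ Ω) p) =
      p.eval (x i) := by
  have := Polynomial.hom_eval₂ p (algebraMap Ω (MvPolynomial σ Ω)) (MvPolynomial.eval x)
    (MvPolynomial.X i)
  rw [Polynomial.aeval_def, this, Polynomial.eval]
  congr 1
  · ext; simp
  · simp

/-- Dividing `X ^ (M + N)` by `P` leaves a remainder `r` of degree at most `N`, and Bézout rewrites
it as `r * (A * P + B * Q)`; `M` is large enough for all the coefficients. -/
lemma IsCoprime.exists_X_pow_relations {P Q : Polynomial Ω} (hPQ : IsCoprime P Q) (hP : P ≠ 0) :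
    ∃ (M : ℕ) (a b a' b' : Polynomial Ω), a.natDegree ≤ M ∧ b.natDegree ≤ M ∧ a'.natDegree ≤ M ∧
      b'.natDegree ≤ M ∧ a * P + b * Q = 1 ∧ a' * P + b' * Q = X ^ (M + P.natDegree) := by
  obtain ⟨A, B, hAB⟩ := hPQ
  set N := P.natDegree with hN
  set M := N + A.natDegree + B.natDegree with hM
  set D := X ^ (M + N) / P with hD
  set r := X ^ (M + N) % P with hr
  have hdiv : P * D + r = X ^ (M + N) := EuclideanDomain.div_add_mod _ _
  have hrdeg : r.natDegree ≤ N := Polynomial.natDegree_le_natDegree (Polynomial.degree_mod_lt _ hP).le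
  have hDdeg : D.natDegree ≤ M := by
    rcases eq_or_ne D 0 with h0 | h0
    · simp [h0]
    have h1 : (P * D).natDegree ≤ M + N := by
      rw [eq_sub_of_add_eq hdiv]
      refine (Polynomial.natDegree_sub_le _ _).trans (max_le ?_ (by omega))
      rw [Polynomial.natDegree_X_pow]
    rw [Polynomial.natDegree_mul hP h0] at h1
    omega
  refine ⟨M, A, B, D + r * A, r * B, by omega, by omega, ?_, ?_, hAB, ?_⟩
  · refine (Polynomial.natDegree_add_le _ _).trans (max_le hDdeg ?_)
    have := Polynomial.natDegree_mul_le (p := r) (q := A)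
    omega
  · have := Polynomial.natDegree_mul_le (p := r) (q := B)
    omega
  · linear_combination hdiv + r * hAB

variable [CharZero Ω] [Algebra.IsAlgebraic ℚ Ω]

open NumberField

lemma absLogHeight₁_le_affinePoint {σ : Type*} [Finite σ] (x : σ → Ω) (i : σ) :
    absLogHeight₁ (x i) ≤ absLogHeight (affinePoint x) := by
  rw [absLogHeight₁_eq]
  convert! absLogHeight_comp_le ![some i, none] (affinePoint x) using 2
  ext k
  fin_cases k <;> rfl

lemma absLogHeight_swap (x y : Ω) : absLogHeight ![x, y] ≤ absLogHeight ![y, x] := by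
  convert! absLogHeight_comp_le ![1, 0] ![y, x] using 2
  ext k
  fin_cases k <;> rfl

theorem IsCoprime.exists_natDegree_mul_absLogHeight₁_le {P Q : Polynomial Ω} (hPQ : IsCoprime P Q) :
    ∃ C : ℝ, ∀ x : Ω, P.natDegree * absLogHeight₁ x ≤ absLogHeight ![P.eval x, Q.eval x] + C := by
  rcases eq_or_ne P 0 with rfl | hP
  · exact ⟨0, fun x => by simpa using absLogHeight_nonneg _⟩
  obtain ⟨M, a, b, a', b', ha, hb, ha', hb', h, h'⟩ := hPQ.exists_X_pow_relations hP
  let ev : Polynomial Ω →ₐ[Ω] MvPolynomial Unit Ω := Polynomial.aeval (MvPolynomial.X ())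
  have hev : ∀ p : Polynomial Ω, (ev p).totalDegree ≤ p.natDegree :=
    MvPolynomial.totalDegree_aeval_X_le ()
  have hdeg : ∀ (o : Option Unit) (i : Fin 2),
      (ev (o.elim (![a, b] i) (fun _ => ![a', b'] i))).totalDegree ≤ M := fun o i => by
    refine (hev _).trans ?_
    cases o <;> fin_cases i <;> simpa
  have hrel : ∀ o : Option Unit, ∑ i : Fin 2, ev (o.elim (![a, b] i) (fun _ => ![a', b'] i)) *
      ev (![P, Q] i) = (o.elim 1 MvPolynomial.X) ^ (M + P.natDegree) := fun o => by
    cases o with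
    | none => simpa using congrArg ev h
    | some i => simpa [ev] using congrArg ev h'
  obtain ⟨C, hC⟩ := exists_le_absLogHeight_eval M P.natDegree (fun i => ev (![P, Q] i))
    (fun o i => ev (o.elim (![a, b] i) (fun _ => ![a', b'] i))) hdeg hrel
  refine ⟨C, fun x => ?_⟩
  have h1 := hC fun _ => x
  have h2 := absLogHeight₁_le_affinePoint (fun _ : Unit => x) ()
  have e : (fun i => MvPolynomial.eval (fun _ => x) (ev (![P, Q] i))) =
      ![P.eval x, Q.eval x] := by
    ext i
    rw [MvPolynomial.eval_aeval_X]
    fin_cases i <;> rfl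
  rw [e] at h1
  exact (mul_le_mul_of_nonneg_left h2 (Nat.cast_nonneg _)).trans h1

theorem IsCoprime.exists_max_natDegree_mul_absLogHeight₁_le {P Q : Polynomial Ω} (hPQ : IsCoprime P Q) :
    ∃ C : ℝ, ∀ x : Ω, (max P.natDegree Q.natDegree : ℕ) * absLogHeight₁ x ≤
      absLogHeight ![P.eval x, Q.eval x] + C := by
  rcases le_total Q.natDegree P.natDegree with h | h
  · rw [max_eq_left h]
    exact hPQ.exists_natDegree_mul_absLogHeight₁_le
  · rw [max_eq_right h]
    obtain ⟨C, hC⟩ := hPQ.symm.exists_natDegree_mul_absLogHeight₁_le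
    exact ⟨C, fun x => (hC x).trans (by linarith [absLogHeight_swap (Q.eval x) (P.eval x)])⟩

/-- The case `y = 0` is included: with `x / 0 = 0` both sides vanish. -/
lemma absLogHeight_eq_absLogHeight₁_div (x y : Ω) :
    absLogHeight ![x, y] = absLogHeight₁ (x / y) := by
  obtain ⟨F, _, u, hu⟩ := exists_numberField_lift ![x, y]
  have h0 : algebraMap F Ω (u 0) = x := hu 0
  have h1 : algebraMap F Ω (u 1) = y := hu 1
  rw [absLogHeight₁_eq, ← h0, ← h1, ← map_div₀, absLogHeight₁_map,
    Height.logHeight₁_div_eq_logHeight, ← absLogHeight_map (algebraMap F Ω)]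
  congr 1
  ext i
  fin_cases i <;> simp

end OneVariable

/-! ### The Northcott property in bounded degree -/

section BoundedDegree

open NumberField

variable {Ω : Type*} [Field Ω] [CharZero Ω] [Algebra.IsAlgebraic ℚ Ω]

lemma absLogHeight₁_zero : absLogHeight₁ (0 : Ω) = 0 := by
  have := absLogHeight₁_map (algebraMap ℚ Ω) 0
  rwa [map_zero, Height.logHeight₁_zero, zero_div, ← absLogHeight₁_eq] at this

lemma absLogHeight₁_one : absLogHeight₁ (1 : Ω) = 0 := by
  have := absLogHeight₁_map (algebraMap ℚ Ω) 1
  rwa [map_one, Height.logHeight₁_one, zero_div, ← absLogHeight₁_eq] at this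

/-- The coefficients of a monic polynomial have heights bounded in terms of those of its roots. -/
lemma exists_absLogHeight₁_coeff_le (T : ℝ) (D : ℕ) : ∃ B : ℝ, 0 ≤ B ∧ ∀ s : Multiset Ω,
    s.card ≤ D → (∀ a ∈ s, absLogHeight₁ a ≤ T) →
      ∀ k, absLogHeight₁ (((s.map fun a => X - C a).prod).coeff k) ≤ B := by
  induction D with
  | zero =>
    refine ⟨0, le_rfl, fun s hs _ k => ?_⟩
    obtain rfl : s = 0 := by simpa using hs
    simp only [Multiset.map_zero, Multiset.prod_zero, Polynomial.coeff_one]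
    split_ifs
    · rw [absLogHeight₁_one]
    · rw [absLogHeight₁_zero]
  | succ D ih =>
    obtain ⟨B, hB0, hB⟩ := ih
    have hlog := Real.log_nonneg (one_le_two (α := ℝ))
    have hT := le_max_right T 0
    -- A new root `a` turns the coefficients `c k` into `c (k - 1) - a * c k`.
    refine ⟨Real.log 2 + B + (max T 0 + B), by positivity, fun s hs hsT k => ?_⟩
    induction s using Multiset.induction with
    | empty =>
      have := hB 0 (by simp) (by simp) k
      linarith
    | cons a s _ =>
      have hBs := hB s (by simpa using hs) fun b hb => hsT b (Multiset.mem_cons_of_mem hb)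
      rw [Multiset.map_cons, Multiset.prod_cons, sub_mul, Polynomial.coeff_sub,
        Polynomial.coeff_C_mul]
      have h1 : absLogHeight₁ ((X * (s.map fun a => X - C a).prod).coeff k) ≤ B := by
        cases k with
        | zero => rw [Polynomial.coeff_X_mul_zero, absLogHeight₁_zero]; exact hB0
        | succ k => rw [Polynomial.coeff_X_mul]; exact hBs k
      have h2 := absLogHeight₁_sub_le ((X * (s.map fun a => X - C a).prod).coeff k)
        (a * ((s.map fun a => X - C a).prod).coeff k)
      have h3 := absLogHeight₁_mul_le a (((s.map fun a => X - C a).prod).coeff k)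
      have h4 := (hsT a (Multiset.mem_cons_self a s)).trans (le_max_left T 0)
      linarith [hBs k]

lemma Polynomial.finite_natDegree_le_coeff_mem {R : Type*} [Semiring R] {A : Set R}
    (hA : A.Finite) (D : ℕ) : {p : R[X] | p.natDegree ≤ D ∧ ∀ k, p.coeff k ∈ A}.Finite := by
  have h : (Set.pi Set.univ fun _ : Fin (D + 1) => A).Finite :=
    Set.Finite.pi fun _ => hA
  refine Set.Finite.of_finite_image (f := fun p (i : Fin (D + 1)) => p.coeff i)
    (h.subset ?_) ?_
  · rintro _ ⟨p, hp, rfl⟩ i _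
    exact hp.2 i
  · intro p hp q hq hpq
    ext k
    by_cases hk : k < D + 1
    · exact congrFun hpq ⟨k, hk⟩
    · rw [Polynomial.coeff_eq_zero_of_natDegree_lt (by have := hp.1; omega),
        Polynomial.coeff_eq_zero_of_natDegree_lt (by have := hq.1; omega)]

/-- The Northcott property passes to elements of bounded degree. -/
theorem finite_minpoly_natDegree_le_absLogHeight₁_le {k : Type*} [Field k] [Algebra k Ω]
    [Normal k Ω] (hk : ∀ T, {a : k | absLogHeight₁ (algebraMap k Ω a) ≤ T}.Finite)
    (D : ℕ) (T : ℝ) :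
    {x : Ω | (minpoly k x).natDegree ≤ D ∧ absLogHeight₁ x ≤ T}.Finite := by
  classical
  obtain ⟨B, -, hB⟩ := exists_absLogHeight₁_coeff_le (Ω := Ω) T D
  refine ((Polynomial.finite_natDegree_le_coeff_mem (hk B) D).biUnion
    fun p _ => (p.rootSet_finite Ω)).subset ?_
  rintro x ⟨hxD, hxT⟩
  have hx : IsIntegral k x := Algebra.IsIntegral.isIntegral x
  have hsplit : ((minpoly k x).map (algebraMap k Ω)).Splits := Normal.splits' x
  refine Set.mem_biUnion (x := minpoly k x) ⟨hxD, fun i => ?_⟩ ?_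
  · change absLogHeight₁ (algebraMap k Ω ((minpoly k x).coeff i)) ≤ B
    rw [← Polynomial.coeff_map, hsplit.eq_prod_roots_of_monic ((minpoly.monic hx).map _)]
    refine hB _ ((Polynomial.card_roots' _).trans (by rwa [Polynomial.natDegree_map])) ?_ i
    intro a ha
    have ha' : (minpoly k x).aeval a = 0 := by
      simpa [Polynomial.aeval_def, Polynomial.eval_map] using
        (Polynomial.mem_roots'.1 ha).2
    have hmin : minpoly k x = minpoly k a :=
      minpoly.eq_of_irreducible_of_monic (minpoly.irreducible hx) ha' (minpoly.monic hx)
    -- Roots of one minimal polynomial are conjugate, and automorphisms preserve the height.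
    obtain ⟨σ, hσ⟩ := (Normal.minpoly_eq_iff_mem_orbit (F := k) (E := Ω)).1 hmin
    have e : σ a = x := hσ
    rw [← e] at hxT
    rwa [← absLogHeight₁_ringHom (σ : Ω →+* Ω) a]
  · exact (Polynomial.mem_rootSet).2 ⟨minpoly.ne_zero hx, minpoly.aeval k x⟩

end BoundedDegree

/-! ### Implications over an arbitrary field -/

section Implications

lemma finite_of_finite_image_apply_zero {α : Type*} {X : Set (Fin 1 → α)}
    (h : ((fun x => x 0) '' X).Finite) : X.Finite :=
  h.of_finite_image fun x _ y _ hxy => funext fun i => by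
    rw [Subsingleton.elim i 0]; exact hxy

variable {K : Type*} [Field K]

/-- Take `Ψ` to be the identity, of degree `1`. -/
lemma PropertyK.propertySP (h : PropertyK K) : PropertySP K := by
  intro n hn f hf X hX
  have hid : ∀ x : Fin n → K, PolyMap.toFun (fun i => MvPolynomial.X i) x = x := fun x => by
    ext i; simp [PolyMap.toFun]
  refine h n hn f (fun i => MvPolynomial.X i) hf (fun i j => ?_) X ?_ fun x _ y _ hxy => ?_
  · rw [MvPolynomial.totalDegree_X]
    exact hf.1 i
  · rw [hX]
    rintro _ ⟨x, hx, rfl⟩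
    rwa [hid]
  · rwa [hid, hid] at hxy

lemma MvPolynomial.exists_polynomial_eval_eq (p : MvPolynomial (Fin 1) K) :
    ∃ P : K[X], p.totalDegree ≤ P.natDegree ∧ ∀ x, MvPolynomial.eval x p = P.eval (x 0) := by
  obtain ⟨P, rfl⟩ : ∃ P : K[X], Polynomial.aeval (MvPolynomial.X 0) P = p :=
    (MvPolynomial.uniqueAlgEquiv K (Fin 1)).symm.surjective p
  exact ⟨P, MvPolynomial.totalDegree_aeval_X_le 0 P, MvPolynomial.eval_aeval_X 0 P⟩

lemma PolyMap.exists_polynomial_of_image_eq {f : PolyMap K 1} (hf : f.IsAdmissible)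
    {X : Set (Fin 1 → K)} (hX : f.toFun '' X = X) :
    ∃ P : K[X], 1 < P.natDegree ∧
      (fun x => P.eval x) '' ((fun x => x 0) '' X) = (fun x => x 0) '' X := by
  obtain ⟨P, hdeg, hP⟩ := MvPolynomial.exists_polynomial_eval_eq (f 0)
  refine ⟨P, (hf.1 0).trans_le hdeg, ?_⟩
  conv_rhs => rw [← hX]
  rw [Set.image_image, Set.image_image]
  exact Set.image_congr fun x _ => (hP x).symm

/-- Elements of `K` have degree `1` over `K`, so `D = 1` serves. -/
lemma PropertyPbar.propertyP (h : PropertyPbar K) : PropertyP K := by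
  intro f hf X hX
  obtain ⟨P, hdeg, hP⟩ := PolyMap.exists_polynomial_of_image_eq hf hX
  set S := (fun x : Fin 1 → K => x 0) '' X
  refine finite_of_finite_image_apply_zero (Set.Finite.of_finite_image
    (h (P.map (algebraMap K (AlgebraicClosure K))) (by rwa [Polynomial.natDegree_map])
      (algebraMap K (AlgebraicClosure K) '' S) ⟨1, ?_⟩ ?_)
    (algebraMap K (AlgebraicClosure K)).injective.injOn)
  · rintro _ ⟨x, -, rfl⟩
    rw [minpoly.eq_X_sub_C, Polynomial.natDegree_X_sub_C]
  · rintro _ ⟨x, hx, rfl⟩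
    rw [← hP] at hx
    obtain ⟨y, hy, rfl⟩ := hx
    exact ⟨_, ⟨y, hy, rfl⟩, by simp [Polynomial.aeval_algebraMap_apply]⟩

/-- An infinite invariant set would give `P * (γX + δ) = αX + β`, impossible for `deg P ≥ 2`. -/
lemma PropertyR.propertyP (h : PropertyR K) : PropertyP K := by
  intro f hf X hX
  obtain ⟨P, hdeg, hP⟩ := PolyMap.exists_polynomial_of_image_eq hf hX
  set S := (fun x : Fin 1 → K => x 0) '' X
  refine finite_of_finite_image_apply_zero (by_contra fun hinf => ?_)
  obtain ⟨α, β, γ, δ, h0, he⟩ := h (algebraMap K[X] (RatFunc K) P)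
    ⟨S, hinf, by simp, by simpa [RatFunc.eval] using hP⟩
  rw [eq_div_iff h0] at he
  have e : ∀ a b : K, RatFunc.C a * RatFunc.X + RatFunc.C b =
      algebraMap K[X] (RatFunc K) (Polynomial.C a * Polynomial.X + Polynomial.C b) := fun a b => by simp
  rw [e] at h0
  rw [e, e, ← map_mul] at he
  have he' := RatFunc.algebraMap_injective K he
  have h0' : Polynomial.C γ * Polynomial.X + Polynomial.C δ ≠ 0 := fun h' => h0 (by rw [h', map_zero])
  have hP0 : P ≠ 0 := by rintro rfl; simp at hdeg
  have h1 : (Polynomial.C α * Polynomial.X + Polynomial.C β).natDegree ≤ 1 := Polynomial.natDegree_linear_le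
  rw [← he', Polynomial.natDegree_mul hP0 h0'] at h1
  omega

lemma PolyMap.eval_elim_eq_affinePoint {n : ℕ} (f : PolyMap K n) (x : Fin n → K) :
    (fun i : Option (Fin n) => MvPolynomial.eval x (i.elim 1 f)) = affinePoint (f.toFun x) := by
  ext i
  cases i <;> simp [affinePoint, PolyMap.toFun]

lemma RatFunc.eq_linear_div_linear (f : RatFunc K) (hn : f.num.natDegree ≤ 1)
    (hd : f.denom.natDegree ≤ 1) :
    ∃ α β γ δ : K, RatFunc.C γ * RatFunc.X + RatFunc.C δ ≠ 0 ∧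
      f = (RatFunc.C α * RatFunc.X + RatFunc.C β) / (RatFunc.C γ * RatFunc.X + RatFunc.C δ) := by
  obtain ⟨α, β, hα⟩ := Polynomial.exists_eq_X_add_C_of_natDegree_le_one hn
  obtain ⟨γ, δ, hγ⟩ := Polynomial.exists_eq_X_add_C_of_natDegree_le_one hd
  have e : ∀ a b : K, RatFunc.C a * RatFunc.X + RatFunc.C b =
      algebraMap K[X] (RatFunc K) (Polynomial.C a * Polynomial.X + Polynomial.C b) := fun a b => by simp
  refine ⟨α, β, γ, δ, ?_, ?_⟩
  · rw [e, ← hγ]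
    exact RatFunc.algebraMap_ne_zero f.denom_ne_zero
  · rw [e, e, ← hα, ← hγ, RatFunc.num_div_denom]

end Implications

/-! ### Consequences of the Northcott property -/

section Northcott

open NumberField

variable {K : Type*} [Field K] [CharZero K] [Algebra.IsAlgebraic ℚ K]

lemma finite_absLogHeight_affinePoint_le (hN : ∀ T, {a : K | absLogHeight₁ a ≤ T}.Finite)
    {n : ℕ} (T : ℝ) : {x : Fin n → K | absLogHeight (affinePoint x) ≤ T}.Finite :=
  (Set.Finite.pi fun _ : Fin n => hN T).subset fun x hx i _ =>
    (absLogHeight₁_le_affinePoint x i).trans hx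

theorem propertyK_of_northcott (hN : ∀ T, {a : K | absLogHeight₁ a ≤ T}.Finite) :
    PropertyK K := by
  intro n hn Φ Ψ hΦ hdeg X hX hinj
  have : Nonempty (Fin n) := ⟨⟨0, hn⟩⟩
  obtain ⟨i₀, hi₀⟩ := Finite.exists_min fun i => (Φ i).totalDegree
  have h2 := hΦ.1 i₀
  obtain ⟨M, q, hq, hrel⟩ := hΦ.exists_relations hi₀
  obtain ⟨C, hC⟩ := exists_le_absLogHeight_eval M (Φ i₀).totalDegree
    (fun i : Option (Fin n) => i.elim 1 Φ) q hq hrel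
  -- The strict gap between the degrees makes this growth rate smaller than that of `Φ`.
  obtain ⟨C', hC'⟩ := exists_absLogHeight_eval_le ((Φ i₀).totalDegree - 1)
    (fun i : Option (Fin n) => i.elim 1 Ψ) fun i => by
      cases i with
      | none => simp
      | some j => exact Nat.le_sub_one_of_lt (hdeg i₀ j)
  simp_rw [PolyMap.eval_elim_eq_affinePoint] at hC hC'
  exact Set.Finite.of_image_subset_of_height_le (h := fun x => absLogHeight (affinePoint x))
    (H := fun x => absLogHeight (affinePoint x)) hX hinj (Nat.cast_nonneg _)
    (Nat.cast_lt.2 (Nat.sub_one_lt (by omega))) (fun x _ => hC x) (fun x _ => hC' x)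
    fun T => (finite_absLogHeight_affinePoint_le hN T).subset fun x hx => hx.2

theorem propertyPbar_of_northcott (hN : ∀ T, {a : K | absLogHeight₁ a ≤ T}.Finite) :
    PropertyPbar K := by
  intro f hf S ⟨D, hD⟩ hS
  have : CharZero (AlgebraicClosure K) := charZero_of_injective_algebraMap
    (algebraMap K (AlgebraicClosure K)).injective
  have : Algebra.IsAlgebraic ℚ (AlgebraicClosure K) := Algebra.IsAlgebraic.trans ℚ K _
  -- With denominator `1`, the pair `![f.eval x, 1]` has the height of `f.eval x`.
  obtain ⟨C, hC⟩ := (isCoprime_one_right (x := f)).exists_natDegree_mul_absLogHeight₁_le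
  simp_rw [Polynomial.eval_one, ← absLogHeight₁_eq] at hC
  refine Set.Finite.of_image_subset_of_height_le (h := absLogHeight₁) (H := absLogHeight₁)
    (A := fun x => f.eval x) (B := id) (e := 1) (C' := 0) (by rwa [Set.image_id])
    Function.injective_id.injOn zero_le_one (Nat.one_lt_cast.2 hf) (fun x _ => hC x)
    (fun x _ => by simp) fun T => ?_
  refine (finite_minpoly_natDegree_le_absLogHeight₁_le (k := K) (fun T => ?_) D T).subset
    fun x hx => ⟨hD x hx.1, hx.2⟩
  simp_rw [absLogHeight₁_ringHom]
  exact hN T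

theorem propertyR_of_northcott (hN : ∀ T, {a : K | absLogHeight₁ a ≤ T}.Finite) :
    PropertyR K := by
  rintro f ⟨S, hinf, -, hS⟩
  by_cases hdeg : max f.num.natDegree f.denom.natDegree ≤ 1
  · exact f.eq_linear_div_linear ((le_max_left _ _).trans hdeg) ((le_max_right _ _).trans hdeg)
  obtain ⟨C, hC⟩ := f.isCoprime_num_denom.exists_max_natDegree_mul_absLogHeight₁_le
  simp_rw [absLogHeight_eq_absLogHeight₁_div] at hC
  -- The degree of `f` is now at least `2`, so the height argument with `B = id` makes `S` finite.
  refine absurd ?_ hinf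
  exact Set.Finite.of_image_subset_of_height_le (h := absLogHeight₁) (H := absLogHeight₁)
    (A := fun x => f.eval (RingHom.id K) x) (B := id) (e := 1) (C' := 0)
    (by rw [Set.image_id, hS]) Function.injective_id.injOn zero_le_one
    (Nat.one_lt_cast.2 (not_le.1 hdeg)) (fun x _ => by simpa [RatFunc.eval] using hC x)
    (fun x _ => by simp) fun T => (hN T).subset fun x hx => hx.2

lemma AlgebraicClosure.isAlgebraic_rat : Algebra.IsAlgebraic ℚ (AlgebraicClosure ℚ) := by
  convert! AlgebraicClosure.isAlgebraic ℚ

lemma PropertyN.finite_absLogHeight₁_le {K : Subfield (AlgebraicClosure ℚ)}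
    (hN : PropertyN (K : Set (AlgebraicClosure ℚ))) [Algebra.IsAlgebraic ℚ K] (T : ℝ) :
    {a : K | absLogHeight₁ a ≤ T}.Finite := by
  have := AlgebraicClosure.isAlgebraic_rat
  -- Property (N) asks for a positive bound and a strict inequality, hence `max T 0 + 1`.
  refine Set.Finite.of_finite_image (f := Subtype.val)
    ((hN (max T 0 + 1) (by positivity)).subset ?_) Subtype.val_injective.injOn
  rintro _ ⟨a, ha, rfl⟩
  refine ⟨a.2, ?_⟩
  have h : absLogHeight₁ (a : AlgebraicClosure ℚ) = absLogHeight₁ a :=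
    absLogHeight₁_ringHom K.subtype a
  rw [h]
  have ha' : absLogHeight₁ a ≤ T := ha
  linarith [le_max_left T 0]

end Northcott

theorem mainTheorem7 :
    (∀ (K : Type*) [Field K],
      (PropertyK K → PropertySP K) ∧ (PropertySP K → PropertyP K) ∧
      (PropertyPbar K → PropertyP K) ∧
      (PropertyR K → PropertyP K)) ∧
    (∀ K : Subfield (AlgebraicClosure ℚ), PropertyN (K : Set (AlgebraicClosure ℚ)) →
      PropertyK K ∧ PropertySP K ∧ PropertyPbar K ∧ PropertyR K ∧ PropertyP K) := by
  refine ⟨fun K _ => ⟨PropertyK.propertySP, fun h => h 1 one_pos, PropertyPbar.propertyP,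
    PropertyR.propertyP⟩, fun K hN => ?_⟩
  have := AlgebraicClosure.isAlgebraic_rat
  have : Algebra.IsAlgebraic ℚ K :=
    Algebra.IsAlgebraic.of_injective K.subtype.toRatAlgHom K.subtype.injective
  have hfin := hN.finite_absLogHeight₁_le
  have hK := propertyK_of_northcott hfin
  exact ⟨hK, hK.propertySP, propertyPbar_of_northcott hfin, propertyR_of_northcott hfin,
    hK.propertySP 1 one_pos⟩
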